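/- Let $V$ be a finite set of nodes, $d\ge 0$ an integer, and let $c_J\in\mathbb{R}$ ($J\subseteq V$) satisfy $c_J=0$ for $|J|>d$. Consider the $0$-$1$ polynomial program $$\min_{x\in\{0,1\}^V}\ \sum_{J\subseteq V} c_J\prod_{j\in J}x_j .$$ Regard it as an energy on the hypergraph $\mathcal{E}=\{J\subseteq V: |J|\le d\}$ with label sets $\{0,1\}$ and cost vector $f$ with components $f_J(x_J)=c_J$ if $x_J=(1,\dots,1)$ and $f_J(x_J)=0$ otherwise ($J\in\mathcal{E}$, $x_J\in\{0,1\}^J$). The full local relaxation (FLP) is the polytope $\Lambda$ of all vectors $\mu=(\mu_J(x_J))_{J\in\mathcal{E},\,x_J\in\{0,1\}^J}$ with $\mu\ge 0$, $\mu_\emptyset=1$ and $\sum_{x_{J\setminus D}}\mu_J(x_J)=\mu_D(x_D)$ for all $D\subsetneq J$ in $\mathcal{E}$ and all $x_D$. A node-wise mapping $p$, $p(x)_s=p_s(x_s)$, has the linear extension $([p]\mu)_J(x_J)=\sum_{x'_J:\,p_J(x'_J)=x_J}\mu_J(x'_J)$; it is called FLP-improving if $\langle f,[p]\mu\rangle\le\langle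 f,\mu\rangle$ for all $\mu\in\Lambda$. It eliminates the label $i$ of node $s$ if $p_s(i)\ne i$. A solution of the FLP maximum persistency problem over a class of node-wise mappings is an FLP-improving mapping of that class which eliminates the largest number of labels. For disjoint $J_1,J_2\subseteq V$ with $|J_1\cup J_2|=d$ and $w\in\mathbb{R}^{2^V}$ let $f_d(J_1,J_2)(w)=\sum_{J'\subseteq J_2}(-1)^{|J'|}w_{J_1\cup J'}$; the inequalities $f_d(J_1,J_2)(w)\ge 0$ are the constraints of the level-$d$ relaxation of Sherali and Adams. Let $V=N^+\cup N^-\cup N^f$ be a partition. Suppose that the following dual-multiplier condition (of Adams, Lassiter and Sherali) holds: there are multipliers $u(J_1,J_2)\ge 0$ of these constraints such that (a) $u(J_1,J_2)=0$ whenever $J_1\cap N^-=\emptyset$ and $J_2\cap N^+=\emptyset$ (complementarity with all relaxed solutions that are $1$ on $N^+$ and $0$ on $N^-$); (b) for every $J\not\subseteq N^f$ the coefficient of $w_J$ in $\sum_{J_1,J_2}u(J_1,J_2)\,f_d(J_1,J_2)(w)$ equals $c_J$ (dual feasibility). Let $p$ be the mapping with $p_s\equiv 1$ for $s\in N^+$,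 $p_s\equiv 0$ for $s\in N^-$ and $p_s=\mathrm{id}$ for $s\in N^f$. Then: 1. $p$ is FLP-improving for $f$, and the partial assignment $x_{N^+}=1$, $x_{N^-}=0$ is persistent: it extends to an optimal solution of the polynomial program. 2. Hence it is dominated by FLP maximum persistency. The mapping $p$ is idempotent, the maximum persistency problem over all idempotent node-wise mappings has a solution, and every solution eliminates at least as many labels as $p$. Moreover, let $y\in\{0,1\}^V$ be any labeling with $y=1$ on $N^+$ and $y=0$ on $N^-$, and consider the class of maps $x\mapsto x[A\leftarrow y]$, $A\subseteq V$ (all-to-one maps), or the class of maps which in every node $s$ keep some labels and send the others to $y_s$ (subset-to-one maps). The class contains $p$, the maximum persistency problem over it has a solution, and every solution eliminates all the labels that $p$ eliminates. -/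

import Mathlib

open Finset

namespace Persistency

/-! ### Energy minimization, local relaxation, relaxed improving mappings -/

/-- Partial labelings `x_C` of the set of nodes `C`, an element of the product of the `X s`, `s ∈ C`. -/
abbrev LocalLabeling {V : Type*} (X : V → Type*) (C : Finset V) : Type _ :=
  ∀ s : {s // s ∈ C}, X s.1

/-- Restriction of `x_C` to a subset `D ⊆ C`. -/
def restrictTo {V : Type*} {X : V → Type*} {C D : Finset V} (h : D ⊆ C)
    (x : LocalLabeling X C) : LocalLabeling X D :=
  fun s => x ⟨s.1, h s.2⟩

/-- The index set `{(C, x_C) | C ∈ E, x_C ∈ X_C}` of the embedding space. -/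
abbrev Index {V : Type*} (E : Finset (Finset V)) (X : V → Type*) : Type _ :=
  Σ C : {C // C ∈ E}, LocalLabeling X C.1

/-- The full local LP relaxation (FLP) polytope of the hypergraph `E`: nonnegative vectors with
`μ_∅ = 1` which satisfy all marginalization constraints between hyperedges `D ⊊ C`. -/
def FLP {V : Type*} [DecidableEq V] (E : Finset (Finset V)) (X : V → Type*)
    [∀ s, Fintype (X s)] [∀ s, DecidableEq (X s)] : Set (Index E X → ℝ) :=
  {μ | (∀ i, 0 ≤ μ i) ∧
    (∀ i : Index E X, i.1.1 = ∅ → μ i = 1) ∧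
    ∀ (C D : {C // C ∈ E}) (h : D.1 ⊂ C.1) (xD : LocalLabeling X D.1),
      ∑ xC ∈ univ.filter (fun xC : LocalLabeling X C.1 => restrictTo h.subset xC = xD),
        μ ⟨C, xC⟩ = μ ⟨D, xD⟩}

/-- Node-wise mappings `p(x)_s = p_s(x_s)`. -/
abbrev NodeMap {V : Type*} (X : V → Type*) : Type _ := ∀ s, X s → X s

/-- The linear extension `[p]` of a node-wise mapping:
`([p] μ)_C (x_C) = ∑_{x'_C} [[p_C(x'_C) = x_C]] μ_C(x'_C)`. -/
def linExt {V : Type*} [DecidableEq V] {E : Finset (Finset V)} {X : V → Type*}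
    [∀ s, Fintype (X s)] [∀ s, DecidableEq (X s)] (p : NodeMap X) :
    (Index E X → ℝ) →ₗ[ℝ] (Index E X → ℝ) where
  toFun μ := fun i => ∑ x' : LocalLabeling X i.1.1,
    (if (fun s => p s.1 (x' s)) = i.2 then (1 : ℝ) else 0) * μ ⟨i.1, x'⟩
  map_add' μ ν := by
    funext i
    simp only [Pi.add_apply, mul_add, sum_add_distrib]
  map_smul' a μ := by
    funext i
    simp only [Pi.smul_apply, smul_eq_mul, RingHom.id_apply, mul_sum]
    exact sum_congr rfl fun x' _ => by ring

/-- A linear mapping `P` is (weakly) `Λ`-improving for the cost vector `f` if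
`⟨f, P μ⟩ ≤ ⟨f, μ⟩` for all `μ ∈ Λ`. -/
def IsImproving {I : Type*} [Fintype I] (Λ : Set (I → ℝ)) (f : I → ℝ)
    (P : (I → ℝ) →ₗ[ℝ] (I → ℝ)) : Prop :=
  ∀ μ ∈ Λ, f ⬝ᵥ P μ ≤ f ⬝ᵥ μ

/-- The labels `(s, i)` eliminated by `p`, those with `p_s(i) ≠ i`. -/
def eliminated {V : Type*} [Fintype V] {X : V → Type*}
    [∀ s, Fintype (X s)] [∀ s, DecidableEq (X s)] (p : NodeMap X) : Finset (Σ s, X s) :=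
  univ.filter fun a => p a.1 a.2 ≠ a.2

/-- All idempotent node-wise mappings. -/
def idempotentMaps {V : Type*} (X : V → Type*) : Set (NodeMap X) :=
  {p | ∀ s i, p s (p s i) = p s i}

/-- The all-to-one maps `x ↦ x[A ← y]` for a fixed labeling `y`. -/
def allToOneMaps {V : Type*} [DecidableEq V] {X : V → Type*} (y : ∀ s, X s) : Set (NodeMap X) :=
  {p | ∃ A : Finset V, ∀ s i, p s i = if s ∈ A then y s else i}

/-- The subset-to-one maps for a fixed labeling `y`: the label `i` of node `s` is kept if
`ζ s i = 1` and is sent to `y s` if `ζ s i = 0`. -/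
def subsetToOneMaps {V : Type*} {X : V → Type*} (y : ∀ s, X s) : Set (NodeMap X) :=
  {p | ∃ ζ : ∀ s, X s → Fin 2, ∀ s i, p s i = if ζ s i = 1 then i else y s}

/-- `q` is an optimal solution of the maximum (weak) persistency problem over the class `S` of
node-wise maps and the FLP relaxation: it maximizes the number of eliminated labels among all
`p ∈ S` such that `[p]` is FLP-improving for `f`. -/
def IsMaxPersistency {V : Type*} [Fintype V] [DecidableEq V] {E : Finset (Finset V)}
    {X : V → Type*} [∀ s, Fintype (X s)] [∀ s, DecidableEq (X s)]
    (S : Set (NodeMap X)) (f : Index E X → ℝ) (q : NodeMap X) : Prop :=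
  (q ∈ S ∧ IsImproving (FLP E X) f (linExt q)) ∧
    ∀ p ∈ S, IsImproving (FLP E X) f (linExt p) → #(eliminated p) ≤ #(eliminated q)

/-! ### 0-1 polynomial programming -/

/-- The objective `∑_J c_J ∏_{j ∈ J} x_j` of the 0-1 polynomial program. -/
def polyObjective {V : Type*} [Fintype V] (c : Finset V → ℝ) (x : V → Fin 2) : ℝ :=
  ∑ J : Finset V, c J * ∏ j ∈ J, ((x j : ℕ) : ℝ)

/-- All sets of at most `d` nodes. -/
def edgesUpTo (V : Type*) [Fintype V] (d : ℕ) : Finset (Finset V) :=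
  univ.filter fun J => #J ≤ d

/-- The polynomial as an energy: `f_J(x_J) = c_J` if `x_J = 1_J`, and `0` otherwise. -/
def polyCost {V : Type*} [Fintype V] [DecidableEq V] (d : ℕ) (c : Finset V → ℝ) :
    Index (edgesUpTo V d) (fun _ => Fin 2) → ℝ :=
  fun i => if i.2 = (fun _ => 1) then c i.1.1 else 0

/-- The linear form `f_d(J₁, J₂) = ∑_{J' ⊆ J₂} (-1)^|J'| w_{J₁ ∪ J'}`, the linearization of
`∏_{j ∈ J₁} x_j ∏_{j ∈ J₂} (1 - x_j)`. -/
def liftForm {V : Type*} [DecidableEq V] (J₁ J₂ : Finset V) (w : Finset V → ℝ) : ℝ :=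
  ∑ J' ∈ J₂.powerset, (-1 : ℝ) ^ #J' * w (J₁ ∪ J')

/-- The index set of the constraints `f_d(J₁, J₂) ≥ 0` of the level-`d` relaxation. -/
def liftPairs (V : Type*) [Fintype V] [DecidableEq V] (d : ℕ) : Finset (Finset V × Finset V) :=
  univ.filter fun K => Disjoint K.1 K.2 ∧ #(K.1 ∪ K.2) = d

/-- The dual-multiplier sufficient condition for the partial assignment `x = 1` on `Np`, `x = 0`
on `Nm`, where `Nf` is the complement of `Np ∪ Nm`. There are dual multipliers
`u(J₁, J₂) ≥ 0` of the constraints `f_d(J₁, J₂) ≥ 0` such that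
* (complementarity) `u(J₁, J₂)` vanishes unless `f_d(J₁, J₂) = 0` is forced by the partial
  assignment, i.e. unless the product `∏_{J₁} x_j ∏_{J₂} (1 - x_j)` has a factor `x_j` with
  `j ∈ Nm` or a factor `1 - x_j` with `j ∈ Np`; in particular `u(J₁, J₂) = 0` if
  `J₁ ∪ J₂ ⊆ Nf`;
* (dual feasibility) for each `J ⊄ Nf` the coefficient of the free variable `w_J` in
  `∑ u(J₁, J₂) f_d(J₁, J₂)` is `c_J`. The coefficient of `w_J` in a linear form is its value at
  the unit vector of `J`.

The coefficients `c_J` with `J ⊆ Nf` do not enter. Nothing is asked about `w_J`, `J ⊆ Nf`; a dual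
solution of the outer problem `∑_{J ⊄ Nf} c_J w_J`, where these coefficients have to be zero, is
a special case. -/
def DualCondition {V : Type*} [Fintype V] [DecidableEq V] (d : ℕ) (c : Finset V → ℝ)
    (Np Nm : Finset V) : Prop :=
  ∃ u : Finset V × Finset V → ℝ,
    (∀ K ∈ liftPairs V d, 0 ≤ u K) ∧
    (∀ K ∈ liftPairs V d, Disjoint K.1 Nm → Disjoint K.2 Np → u K = 0) ∧
    ∀ J : Finset V, ¬ J ⊆ (Np ∪ Nm)ᶜ →
      ∑ K ∈ liftPairs V d, u K * liftForm K.1 K.2 (Pi.single J 1) = c J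

/-- The mapping `p_s(x_s) = 0` on `Nm`, `1` on `Np`, and `x_s` otherwise. -/
def overwrite {V : Type*} [DecidableEq V] (Np Nm : Finset V) : NodeMap (fun _ : V => Fin 2) :=
  fun s i => if s ∈ Nm then 0 else if s ∈ Np then 1 else i

end Persistency

namespace Persistency

/-! ### Overwriting classes and their closure under composition. -/

section Classes

variable {V : Type*} {X : V → Type*}

/-! For `μ` in the FLP polytope put `w_J = μ_J(1,…,1)`. The energy is then `∑ c_J w_J`, and by
inclusion-exclusion the lift form of `(J₁, J₂)` at `w` is the entry of `μ` on `J₁ ∪ J₂` with labels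
`1` on `J₁` and `0` on `J₂` (`liftForm_component`), hence nonnegative. Let `w'` come from `[p]μ`.
Since `w_J = w'_J` for `J ⊆ Nf`, dual feasibility turns the energy drop into `∑ u(K) (f_K(w) -
f_K(w'))`. By complementarity, `u(K) ≠ 0` only if the labeling of `K` uses a label outside the image
of `p`; then `f_K(w') = 0` and the term is nonnegative (`DualCondition.isImproving`).

Persistency follows by applying this to the vector of an optimal labeling. Label-by-label domination
is a composition argument: `p ∘ q` is again improving and in the class, and it eliminates what `p`
or `q` does, so a maximal `q` already eliminates all that `p` does. -/

theorem comp_mem_subsetToOneMaps {y : ∀ s, X s} {p q : NodeMap X}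
    (hp : p ∈ subsetToOneMaps y) (hq : q ∈ subsetToOneMaps y) :
    (fun s i => p s (q s i)) ∈ subsetToOneMaps y := by
  obtain ⟨ζ, hζ⟩ := hp
  obtain ⟨ξ, hξ⟩ := hq
  -- A label is kept iff both maps keep it; `y s` is a fixed point of either map.
  refine ⟨fun s i => if ξ s i = 1 then ζ s i else 0, fun s i => ?_⟩
  simp only [hζ, hξ]
  split_ifs <;> simp_all

variable [DecidableEq V]

theorem allToOneMaps_subset_subsetToOneMaps (y : ∀ s, X s) :
    allToOneMaps y ⊆ subsetToOneMaps y := by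
  rintro p ⟨A, hA⟩
  refine ⟨fun s _ => if s ∈ A then 0 else 1, fun s i => ?_⟩
  rw [hA]
  split_ifs <;> simp_all

theorem comp_mem_allToOneMaps {y : ∀ s, X s} {p q : NodeMap X} (hp : p ∈ allToOneMaps y)
    (hq : q ∈ allToOneMaps y) : (fun s i => p s (q s i)) ∈ allToOneMaps y := by
  obtain ⟨A, hA⟩ := hp
  obtain ⟨B, hB⟩ := hq
  refine ⟨A ∪ B, fun s i => ?_⟩
  simp only [hA, hB, mem_union]
  split_ifs <;> simp_all

theorem overwrite_mem_allToOneMaps {Np Nm : Finset V}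
    {y : V → Fin 2}
    (hp : ∀ s ∈ Np, y s = 1) (hm : ∀ s ∈ Nm, y s = 0) :
    overwrite Np Nm ∈ allToOneMaps (X := fun _ => Fin 2) y := by
  refine ⟨Np ∪ Nm, fun s i => ?_⟩
  by_cases h1 : s ∈ Nm
  · simp [overwrite, h1, hm s h1]
  · by_cases h2 : s ∈ Np
    · simp [overwrite, h1, h2, hp s h2]
    · simp [overwrite, h1, h2]

end Classes

/-! ### Linear extensions, composition and maximal persistency. -/

section General

variable {V : Type*} [DecidableEq V] {E : Finset (Finset V)} {X : V → Type*}
  [∀ s, Fintype (X s)] [∀ s, DecidableEq (X s)]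

/-- The linear extension of a node-wise mapping maps the FLP polytope into itself. -/
theorem linExt_mem_FLP (p : NodeMap X) {μ : Index E X → ℝ} (hμ : μ ∈ FLP E X) :
    linExt p μ ∈ FLP E X := by
  obtain ⟨h0, h1, h2⟩ := hμ
  refine ⟨fun i => ?_, ?_, ?_⟩
  · refine sum_nonneg fun x' _ => mul_nonneg ?_ (h0 _)
    split_ifs <;> norm_num
  · rintro ⟨⟨C, hC⟩, x⟩ hi
    obtain rfl : C = ∅ := hi
    have : IsEmpty {s // s ∈ (∅ : Finset V)} := ⟨fun s => absurd s.2 (notMem_empty _)⟩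
    change ∑ x' : LocalLabeling X ∅, _ = _
    rw [Fintype.sum_eq_single x fun y hy => absurd (Subsingleton.elim y x) hy,
      if_pos (Subsingleton.elim _ _), one_mul]
    exact h1 _ rfl
  · intro C D h xD
    change ∑ xC ∈ _, ∑ x' : LocalLabeling X C.1,
        (if (fun s => p s.1 (x' s)) = xC then (1 : ℝ) else 0) * μ ⟨C, x'⟩ =
      ∑ x' : LocalLabeling X D.1,
        (if (fun s => p s.1 (x' s)) = xD then (1 : ℝ) else 0) * μ ⟨D, x'⟩
    -- Lifting each entry on `D` to its fiber over `C` makes both sides sums over labelings of `C`.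
    have hR : ∀ x' : LocalLabeling X D.1,
        (if (fun s => p s.1 (x' s)) = xD then (1 : ℝ) else 0) * μ ⟨D, x'⟩ =
        ∑ xC ∈ univ.filter (fun xC : LocalLabeling X C.1 => restrictTo h.subset xC = x'),
          (if (fun s => p s.1 (restrictTo h.subset xC s)) = xD then (1 : ℝ) else 0) *
            μ ⟨C, xC⟩ := by
      intro x'
      rw [← h2 C D h x', mul_sum]
      refine sum_congr rfl fun xC hxC => ?_
      rw [(mem_filter.1 hxC).2]
    simp_rw [hR]
    rw [sum_fiberwise, sum_comm]
    refine sum_congr rfl fun x' _ => ?_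
    rw [← sum_mul, sum_ite_eq]
    congr 1
    simp only [mem_filter, mem_univ, true_and]
    rfl

/-- The linear extension of a composition is the composition of the linear extensions. -/
theorem linExt_comp (p q : NodeMap X) (μ : Index E X → ℝ) :
    linExt (fun s i => p s (q s i)) μ = linExt p (linExt q μ) := by
  funext i
  change ∑ x' : LocalLabeling X i.1.1,
      (if (fun s => p s.1 (q s.1 (x' s))) = i.2 then (1 : ℝ) else 0) * μ ⟨i.1, x'⟩ =
    ∑ x : LocalLabeling X i.1.1, (if (fun s => p s.1 (x s)) = i.2 then (1 : ℝ) else 0) *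
      ∑ x' : LocalLabeling X i.1.1,
        (if (fun s => q s.1 (x' s)) = x then (1 : ℝ) else 0) * μ ⟨i.1, x'⟩
  simp_rw [mul_sum]
  rw [sum_comm]
  refine sum_congr rfl fun x' _ => ?_
  rw [Fintype.sum_eq_single (fun s => q s.1 (x' s))]
  · rw [if_pos rfl, one_mul]
  · intro x hx
    rw [if_neg hx.symm, zero_mul, mul_zero]

/-- The inequality for `p` may be used at `[q]μ`, because that point stays in the polytope. -/
theorem IsImproving.comp [Fintype V] {f : Index E X → ℝ} {p q : NodeMap X}
    (hp : IsImproving (FLP E X) f (linExt p)) (hq : IsImproving (FLP E X) f (linExt q)) :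
    IsImproving (FLP E X) f (linExt fun s i => p s (q s i)) := by
  intro μ hμ
  rw [linExt_comp]
  exact (hp _ (linExt_mem_FLP q hμ)).trans (hq μ hμ)

/-- The vector of the embedding space that represents the labeling `x`. -/
def embed (E : Finset (Finset V)) (x : ∀ s, X s) : Index E X → ℝ :=
  fun i => if (fun s : {s // s ∈ i.1.1} => x s.1) = i.2 then 1 else 0

theorem embed_mem_FLP (x : ∀ s, X s) : embed E x ∈ FLP E X := by
  refine ⟨fun i => ?_, ?_, ?_⟩
  · unfold embed
    split_ifs <;> norm_num
  · rintro ⟨⟨C, hC⟩, y⟩ hi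
    obtain rfl : C = ∅ := hi
    have : IsEmpty {s // s ∈ (∅ : Finset V)} := ⟨fun s => absurd s.2 (notMem_empty _)⟩
    exact if_pos (Subsingleton.elim _ _)
  · intro C D h xD
    change ∑ xC ∈ _, (if (fun s : {s // s ∈ C.1} => x s.1) = xC then (1 : ℝ) else 0) =
      if (fun s : {s // s ∈ D.1} => x s.1) = xD then 1 else 0
    rw [sum_ite_eq]
    simp only [mem_filter, mem_univ, true_and]
    rfl

theorem linExt_embed (p : NodeMap X) (x : ∀ s, X s) :
    linExt p (embed E x) = embed E fun s => p s (x s) := by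
  funext i
  change ∑ x' : LocalLabeling X i.1.1, (if (fun s => p s.1 (x' s)) = i.2 then (1 : ℝ) else 0) *
    (if (fun s : {s // s ∈ i.1.1} => x s.1) = x' then 1 else 0) =
      if (fun s : {s // s ∈ i.1.1} => p s.1 (x s.1)) = i.2 then 1 else 0
  simp

/-- The maximum persistency problem has a solution as soon as it has a feasible point. -/
theorem exists_isMaxPersistency [Fintype V] {S : Set (NodeMap X)} {f : Index E X → ℝ}
    {p : NodeMap X} (hp : p ∈ S) (himp : IsImproving (FLP E X) f (linExt p)) :
    ∃ q, IsMaxPersistency S f q := by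
  obtain ⟨q, hq, hmax⟩ := Set.exists_max_image
    {p | p ∈ S ∧ IsImproving (FLP E X) f (linExt p)} (fun p => #(eliminated p))
    (Set.toFinite _) ⟨p, hp, himp⟩
  exact ⟨q, hq, fun p h h' => hmax p ⟨h, h'⟩⟩

/-- A subset-to-one map composed with another one for the same labeling eliminates the labels
that either of them eliminates. -/
theorem eliminated_union_subset_comp [Fintype V] {y : ∀ s, X s} {p q : NodeMap X}
    (hp : p ∈ subsetToOneMaps y) (hq : q ∈ subsetToOneMaps y) :
    eliminated p ∪ eliminated q ⊆ eliminated fun s i => p s (q s i) := by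
  obtain ⟨ζ, hζ⟩ := hp
  obtain ⟨ξ, hξ⟩ := hq
  rintro ⟨s, i⟩ h
  simp only [eliminated, mem_union, mem_filter, mem_univ, true_and, hζ, hξ] at h ⊢
  by_cases h1 : ξ s i = 1 <;> by_cases h2 : ζ s i = 1 <;> simp_all

/-- A solution of the maximum persistency problem over a class of subset-to-one maps closed under
composition eliminates every label eliminated by some improving map of the class. -/
theorem IsMaxPersistency.eliminated_subset [Fintype V] {y : ∀ s, X s} {S : Set (NodeMap X)}
    {f : Index E X → ℝ} {p q : NodeMap X} (hS : S ⊆ subsetToOneMaps y)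
    (hcomp : ∀ p ∈ S, ∀ q ∈ S, (fun s i => p s (q s i)) ∈ S) (hp : p ∈ S)
    (himp : IsImproving (FLP E X) f (linExt p)) (hq : IsMaxPersistency S f q) :
    eliminated p ⊆ eliminated q := by
  have hle := hq.2 _ (hcomp p hp q hq.1.1) (himp.comp hq.1.2)
  have hsub := eliminated_union_subset_comp (hS hp) (hS hq.1.1)
  -- Maximality of `q` against `p ∘ q` leaves no room for a label outside `eliminated q`.
  have heq := eq_of_subset_of_card_le (subset_union_right (s₁ := eliminated p))
    ((card_le_card hsub).trans hle)
  rw [heq]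
  exact subset_union_left

end General

/-! ### Lift forms and the polynomial energy on the FLP polytope. -/

section Polynomial

variable {V : Type*} [DecidableEq V]

theorem liftForm_eq_sum [Fintype V] (J₁ J₂ : Finset V) (w : Finset V → ℝ) :
    liftForm J₁ J₂ w = ∑ J, liftForm J₁ J₂ (Pi.single J 1) * w J := by
  unfold liftForm
  simp_rw [sum_mul]
  rw [sum_comm]
  refine sum_congr rfl fun J' _ => ?_
  rw [Fintype.sum_eq_single (J₁ ∪ J')]
  · simp
  · intro J hJ
    rw [Pi.single_eq_of_ne hJ.symm, mul_zero, zero_mul]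

theorem liftForm_sub (J₁ J₂ : Finset V) (w v : Finset V → ℝ) :
    liftForm J₁ J₂ (fun J => w J - v J) = liftForm J₁ J₂ w - liftForm J₁ J₂ v := by
  simp only [liftForm, mul_sub, sum_sub_distrib]

/-- Linearized form of multiplying by `1 - x_j`: split the subsets `J'` by whether they contain `j`.
-/
theorem liftForm_insert {J₁ J₂ : Finset V} {j : V} (hj : j ∉ J₂) (w : Finset V → ℝ) :
    liftForm J₁ (insert j J₂) w = liftForm J₁ J₂ w - liftForm (insert j J₁) J₂ w := by
  unfold liftForm
  rw [sum_powerset_insert hj, sub_eq_add_neg, ← sum_neg_distrib]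
  congr 1
  refine sum_congr rfl fun J' hJ' => ?_
  rw [card_insert_of_notMem fun h => hj (mem_powerset.1 hJ' h), pow_succ, union_insert,
    insert_union]
  ring

variable [Fintype V] {d : ℕ}

/-- The component of `μ` at the hyperedge `C` and the restriction of `x` to `C`, extended by zero
to all sets `C` of nodes. -/
def component (μ : Index (edgesUpTo V d) (fun _ => Fin 2) → ℝ) (x : V → Fin 2)
    (C : Finset V) : ℝ :=
  if h : C ∈ edgesUpTo V d then μ ⟨⟨C, h⟩, fun s => x s.1⟩ else 0

theorem component_congr (μ : Index (edgesUpTo V d) (fun _ => Fin 2) → ℝ) {x y : V → Fin 2}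
    {C : Finset V} (h : ∀ s ∈ C, x s = y s) : component μ x C = component μ y C := by
  have : (fun s : {s // s ∈ C} => x s.1) = fun s => y s.1 := funext fun s => h s.1 s.2
  simp only [component, this]

theorem component_nonneg {μ : Index (edgesUpTo V d) (fun _ => Fin 2) → ℝ}
    (hμ : μ ∈ FLP (edgesUpTo V d) fun _ => Fin 2) (x : V → Fin 2) (C : Finset V) :
    0 ≤ component μ x C := by
  unfold component
  split_ifs
  exacts [hμ.1 _, le_rfl]

/-- Marginalization over the single node `j`, whose fiber consists of its two labels. -/
theorem component_eq_add {μ : Index (edgesUpTo V d) (fun _ => Fin 2) → ℝ}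
    (hμ : μ ∈ FLP (edgesUpTo V d) fun _ => Fin 2) (x : V → Fin 2) {C : Finset V} {j : V}
    (hj : j ∉ C) (hC : #(insert j C) ≤ d) :
    component μ x C = component μ (Function.update x j 0) (insert j C) +
      component μ (Function.update x j 1) (insert j C) := by
  have hC1 : insert j C ∈ edgesUpTo V d := mem_filter.2 ⟨mem_univ _, hC⟩
  have hC0 : C ∈ edgesUpTo V d :=
    mem_filter.2 ⟨mem_univ _, (card_le_card (subset_insert j C)).trans hC⟩
  simp only [component, dif_pos hC1, dif_pos hC0]
  rw [← hμ.2.2 ⟨_, hC1⟩ ⟨_, hC0⟩ (ssubset_insert hj) fun s => x s.1,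
    ← Fin.sum_univ_two fun b : Fin 2 =>
      μ ⟨⟨insert j C, hC1⟩, fun s => Function.update x j b s.1⟩]
  symm
  refine sum_bij' (fun b _ s => Function.update x j b s.1)
    (fun xC _ => xC ⟨j, mem_insert_self j C⟩) ?_ ?_ ?_ ?_ ?_
  · intro b _
    refine mem_filter.2 ⟨mem_univ _, funext fun s => ?_⟩
    exact Function.update_of_ne (ne_of_mem_of_not_mem s.2 hj) _ _
  · exact fun _ _ => mem_univ _
  · intro b _
    simp
  · intro xC hxC
    funext ⟨s, hs⟩
    have h := (mem_filter.1 hxC).2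
    by_cases hsj : s = j
    · subst hsj
      simp
    · change Function.update x j _ s = _
      rw [Function.update_of_ne hsj]
      exact (congrFun h ⟨s, (mem_insert.1 hs).resolve_left hsj⟩).symm
  · exact fun _ _ => rfl

/-- On the FLP polytope, the constraint `(J₁, J₂)` of the lift takes the value of the component
of `J₁ ∪ J₂` with the labels `1` on `J₁` and `0` on `J₂`. -/
theorem liftForm_component {μ : Index (edgesUpTo V d) (fun _ => Fin 2) → ℝ}
    (hμ : μ ∈ FLP (edgesUpTo V d) fun _ => Fin 2) (J₂ : Finset V) :
    ∀ J₁ : Finset V, Disjoint J₁ J₂ → #(J₁ ∪ J₂) ≤ d →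
      liftForm J₁ J₂ (component μ fun _ => 1) =
        component μ (fun s => if s ∈ J₁ then 1 else 0) (J₁ ∪ J₂) := by
  induction J₂ using Finset.induction_on with
  | empty =>
    intro J₁ _ _
    simp only [liftForm, powerset_empty, sum_singleton, card_empty, pow_zero, one_mul, union_empty]
    exact component_congr _ fun s hs => by simp [hs]
  | insert j J₂ hj ih =>
    intro J₁ hd hc
    rw [disjoint_insert_right] at hd
    rw [union_insert] at hc
    have hju : j ∉ J₁ ∪ J₂ := by simp [hd.1, hj]
    -- The marginal on `J₁ ∪ J₂` splits by the label of `j`; the subtracted term is the part with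
    -- label `1`, so label `0` remains.
    rw [liftForm_insert hj, ih J₁ hd.2 ((card_le_card (subset_insert _ _)).trans hc),
      ih (insert j J₁) (disjoint_insert_left.2 ⟨hj, hd.2⟩) (by rwa [insert_union]),
      component_eq_add hμ _ hju hc, insert_union, union_insert]
    rw [component_congr μ (C := insert j (J₁ ∪ J₂))
      (x := Function.update (fun s => if s ∈ J₁ then 1 else 0) j 1)
      (y := fun s => if s ∈ insert j J₁ then 1 else 0), add_sub_cancel_right]
    · refine component_congr _ fun s _ => ?_
      by_cases hs : s = j
      · subst hs
        simp [hd.1]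
      · simp [hs]
    · intro s _
      by_cases hs : s = j
      · subst hs
        simp
      · simp [hs]

theorem polyCost_dotProduct (c : Finset V → ℝ)
    (μ : Index (edgesUpTo V d) (fun _ => Fin 2) → ℝ) :
    polyCost d c ⬝ᵥ μ = ∑ J, c J * component μ (fun _ => 1) J := by
  have h : ∀ J : Finset V, J ∉ edgesUpTo V d → c J * component μ (fun _ => 1) J = 0 := by
    intro J hJ
    rw [component, dif_neg hJ, mul_zero]
  rw [← sum_subset (subset_univ (edgesUpTo V d)) fun J _ hJ => h J hJ, ← sum_coe_sort]
  unfold dotProduct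
  rw [Fintype.sum_sigma]
  refine sum_congr rfl fun J _ => ?_
  rw [Fintype.sum_eq_single fun _ => (1 : Fin 2)]
  · simp [polyCost, component, J.2]
  · intro x hx
    simp [polyCost, hx]

/-- A monomial of 0-1 values is the indicator of the all-ones labeling; `hc` removes the monomials
outside the hypergraph. -/
theorem polyCost_dotProduct_embed {c : Finset V → ℝ} (hc : ∀ J : Finset V, d < #J → c J = 0)
    (x : V → Fin 2) :
    polyCost d c ⬝ᵥ embed (X := fun _ => Fin 2) (edgesUpTo V d) x = polyObjective c x := by
  rw [polyCost_dotProduct]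
  refine sum_congr rfl fun J _ => ?_
  by_cases hJ : d < #J
  · rw [hc J hJ, zero_mul, zero_mul]
  · have hJ' : J ∈ edgesUpTo V d := mem_filter.2 ⟨mem_univ _, not_lt.1 hJ⟩
    congr 1
    rw [component, dif_pos hJ']
    change (if (fun s : {s // s ∈ J} => x s.1) = (fun _ => 1) then (1 : ℝ) else 0) = _
    split_ifs with h
    · refine (prod_eq_one fun j hj => ?_).symm
      have : x j = 1 := congrFun h ⟨j, hj⟩
      simp [this]
    · obtain ⟨⟨j, hj⟩, hx⟩ := Function.ne_iff.1 h
      refine (prod_eq_zero hj ?_).symm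
      have hx0 : x j = 0 := by
        change x j ≠ 1 at hx
        omega
      simp [hx0]

theorem component_linExt_eq_self {p : NodeMap fun _ : V => Fin 2} {C : Finset V}
    (hp : ∀ s ∈ C, ∀ i, p s i = i) (μ : Index (edgesUpTo V d) (fun _ => Fin 2) → ℝ)
    (x : V → Fin 2) : component (linExt p μ) x C = component μ x C := by
  unfold component
  split_ifs with h
  · change ∑ x' : LocalLabeling (fun _ => Fin 2) C, (if (fun s => p s.1 (x' s)) = _ then (1 : ℝ)
      else 0) * _ = _
    rw [Fintype.sum_eq_single fun s => x s.1]
    · have hx : (fun s : {s // s ∈ C} => p s.1 (x s.1)) = fun s => x s.1 :=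
        funext fun s => hp s.1 s.2 _
      exact (congrArg (· * _) (if_pos hx)).trans (one_mul _)
    · intro x' hx'
      rw [if_neg, zero_mul]
      rwa [show (fun s : {s // s ∈ C} => p s.1 (x' s)) = x' from funext fun s => hp s.1 s.2 _]
  · rfl

/-- A labeling with a label outside the image of `p` has no preimage, so it receives no mass. -/
theorem component_linExt_eq_zero {p : NodeMap fun _ : V => Fin 2} {C : Finset V}
    {x : V → Fin 2} {j : V} (hj : j ∈ C) (hp : ∀ i, p j i ≠ x j)
    (μ : Index (edgesUpTo V d) (fun _ => Fin 2) → ℝ) : component (linExt p μ) x C = 0 := by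
  unfold component
  split_ifs with h
  · refine sum_eq_zero fun x' _ => ?_
    rw [if_neg, zero_mul]
    exact fun heq => hp _ (congrFun heq ⟨j, hj⟩)
  · rfl

/-- The dual-multiplier condition makes the overwriting map FLP-improving. -/
theorem DualCondition.isImproving {c : Finset V → ℝ} {Np Nm : Finset V}
    (hdisj : Disjoint Np Nm) (hcond : DualCondition d c Np Nm) :
    IsImproving (FLP (edgesUpTo V d) (fun _ => Fin 2)) (polyCost d c)
      (linExt (overwrite Np Nm)) := by
  intro μ hμ
  obtain ⟨u, hu0, hu1, hu2⟩ := hcond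
  set ν := linExt (overwrite Np Nm) μ with hν
  have hνF : ν ∈ FLP (edgesUpTo V d) fun _ => Fin 2 := linExt_mem_FLP _ hμ
  rw [← sub_nonneg, polyCost_dotProduct, polyCost_dotProduct, ← sum_sub_distrib]
  have key : ∑ J, (c J * component μ (fun _ => 1) J - c J * component ν (fun _ => 1) J) =
      ∑ K ∈ liftPairs V d, u K *
        (liftForm K.1 K.2 (component μ fun _ => 1) -
          liftForm K.1 K.2 (component ν fun _ => 1)) := by
    simp_rw [← liftForm_sub]
    simp_rw [liftForm_eq_sum _ _ (fun J => component μ (fun _ => 1) J - _), mul_sum]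
    rw [sum_comm]
    refine sum_congr rfl fun J _ => ?_
    rw [← mul_sub]
    -- Inside `Nf` the coefficients are unconstrained, but there the two components agree.
    by_cases hJ : J ⊆ (Np ∪ Nm)ᶜ
    · have : component ν (fun _ => 1) J = component μ (fun _ => 1) J := by
        refine component_linExt_eq_self (fun s hs i => ?_) _ _
        have hs' := hJ hs
        simp only [mem_compl, mem_union, not_or] at hs'
        simp [overwrite, hs'.1, hs'.2]
      simp [this]
    · simp_rw [← hu2 J hJ, sum_mul, mul_assoc]
  rw [key]
  refine sum_nonneg fun K hK => ?_
  obtain ⟨hKd, hKc⟩ := (mem_filter.1 hK).2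
  by_cases hvan : Disjoint K.1 Nm ∧ Disjoint K.2 Np
  · rw [hu1 K hK hvan.1 hvan.2, zero_mul]
  refine mul_nonneg (hu0 K hK) ?_
  rw [liftForm_component hμ _ _ hKd hKc.le, liftForm_component hνF _ _ hKd hKc.le]
  suffices h : component ν (fun s => if s ∈ K.1 then 1 else 0) (K.1 ∪ K.2) = 0 by
    rw [h, sub_zero]
    exact component_nonneg hμ _ _
  rw [not_and_or, not_disjoint_iff, not_disjoint_iff] at hvan
  obtain ⟨j, hj, hjm⟩ | ⟨j, hj, hjp⟩ := hvan
  · refine component_linExt_eq_zero (mem_union_left _ hj) (fun i => ?_) μ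
    simp [overwrite, hjm, hj]
  · refine component_linExt_eq_zero (mem_union_right _ hj) (fun i => ?_) μ
    simp [overwrite, hjp, disjoint_left.1 hdisj hjp, disjoint_right.1 hKd hj]

end Polynomial

end Persistency

open Persistency in
theorem mainTheorem12 {V : Type*} [Fintype V] [DecidableEq V] (d : ℕ) (c : Finset V → ℝ)
    (hc : ∀ J : Finset V, d < #J → c J = 0)
    (Np Nm : Finset V) (hdisj : Disjoint Np Nm) (hcond : DualCondition d c Np Nm) :
    -- the mapping is FLP-improving
    IsImproving (FLP (edgesUpTo V d) (fun _ => Fin 2)) (polyCost d c)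
      (linExt (overwrite Np Nm)) ∧
    -- the partial assignment is persistent
    (∃ x : V → Fin 2, (∀ z, polyObjective c x ≤ polyObjective c z) ∧
      (∀ s ∈ Np, x s = 1) ∧ ∀ s ∈ Nm, x s = 0) ∧
    -- domination by FLP maximum persistency over all idempotent node-wise maps
    overwrite Np Nm ∈ idempotentMaps (fun _ : V => Fin 2) ∧
    (∃ q, IsMaxPersistency (idempotentMaps (fun _ : V => Fin 2)) (polyCost d c) q) ∧
    (∀ q, IsMaxPersistency (idempotentMaps (fun _ : V => Fin 2)) (polyCost d c) q →
      #(eliminated (overwrite Np Nm)) ≤ #(eliminated q)) ∧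
    -- domination, label by label, for each test labeling that extends the partial assignment
    ∀ y : V → Fin 2, (∀ s ∈ Np, y s = 1) → (∀ s ∈ Nm, y s = 0) →
      ∀ S : Set (NodeMap (fun _ : V => Fin 2)), S = allToOneMaps y ∨ S = subsetToOneMaps y →
        overwrite Np Nm ∈ S ∧ (∃ q, IsMaxPersistency S (polyCost d c) q) ∧
        ∀ q, IsMaxPersistency S (polyCost d c) q →
          eliminated (overwrite Np Nm) ⊆ eliminated q := by
  have himp := hcond.isImproving hdisj
  have hidem : overwrite Np Nm ∈ idempotentMaps (fun _ : V => Fin 2) := by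
    intro s i
    unfold overwrite
    split_ifs <;> rfl
  refine ⟨himp, ?_, hidem, exists_isMaxPersistency hidem himp,
    fun q hq => hq.2 _ hidem himp, ?_⟩
  · obtain ⟨x, hx⟩ := Finite.exists_min (polyObjective (V := V) c)
    -- Overwriting an arbitrary minimizer does not raise its value.
    refine ⟨fun s => overwrite Np Nm s (x s), fun z => ?_, fun s hs => ?_, fun s hs => ?_⟩
    · have h := himp _ (embed_mem_FLP x)
      rw [linExt_embed, polyCost_dotProduct_embed hc, polyCost_dotProduct_embed hc] at h
      exact h.trans (hx z)
    · simp [overwrite, hs, disjoint_left.1 hdisj hs]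
    · simp [overwrite, hs]
  · intro y hp hm S hS
    have hall := overwrite_mem_allToOneMaps hp hm
    have hsub := allToOneMaps_subset_subsetToOneMaps (X := fun _ : V => Fin 2) y
    obtain rfl | rfl := hS
    · exact ⟨hall, exists_isMaxPersistency hall himp, fun q hq =>
        hq.eliminated_subset hsub (fun _ h _ h' => comp_mem_allToOneMaps h h') hall himp⟩
    · exact ⟨hsub hall, exists_isMaxPersistency (hsub hall) himp, fun q hq =>
        hq.eliminated_subset subset_rfl (fun _ h _ h' => comp_mem_subsetToOneMaps h h')
          (hsub hall) himp⟩
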